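/- Let $d\ge 1$ be an integer and let $S^d\subset\mathbb{R}^{d+1}$ be the unit sphere with surface measure $\sigma_d$. A spherical $3$-design on $S^d$ is a nonempty finite set $X\subset S^d$ such that $$\frac{1}{\sigma_d(S^d)}\int_{S^d} f\,d\sigma_d=\frac{1}{|X|}\sum_{x\in X}f(x)$$ for every real polynomial $f(x_0,\dots,x_d)$ of total degree at most $3$; its size is the number $|X|$ of its (distinct) points. **Theorem 7.1.** No spherical $3$-design on $S^d$ has size $n<2d+2$. Spherical $3$-designs on $S^d$ of size $n$ exist when (i) $n$ is even and $n\ge 2(d+1)$; (ii) $n$ is odd and $n\ge 5(d+1)/2$, except possibly for $(d,n)=(2,9)$ and $(d,n)=(4,13)$. -/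

import Mathlib

open MeasureTheory

noncomputable section

/-- The unit sphere `S^d` in the Euclidean space `ℝ^(d+1)`. -/
abbrev UnitSphere (d : ℕ) : Type :=
  Metric.sphere (0 : EuclideanSpace ℝ (Fin (d + 1))) 1

/-- The surface measure on `S^d` induced by Lebesgue measure on `ℝ^(d+1)`. -/
def surfaceMeasure (d : ℕ) : Measure (UnitSphere d) :=
  (volume : Measure (EuclideanSpace ℝ (Fin (d + 1)))).toSphere

/-- The value at a point of the sphere of a real polynomial in the `d + 1` coordinates. -/
def polyValue {d : ℕ} (f : MvPolynomial (Fin (d + 1)) ℝ) (x : UnitSphere d) : ℝ :=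
  MvPolynomial.eval (fun i => (x : EuclideanSpace ℝ (Fin (d + 1))) i) f

/-- A spherical `t`-design on `S^d`: a nonempty finite set `X` of points of the sphere such that
every real polynomial of degree at most `t` has the same average over the whole sphere (with
respect to surface measure) as over `X`. -/
def IsSphericalDesign (d t : ℕ) (X : Finset (UnitSphere d)) : Prop :=
  X.Nonempty ∧ ∀ f : MvPolynomial (Fin (d + 1)) ℝ, f.totalDegree ≤ t →
    (1 / (surfaceMeasure d).real Set.univ) * ∫ x, polyValue f x ∂(surfaceMeasure d)
      = (1 / (X.card : ℝ)) * ∑ x ∈ X, polyValue f x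

end

/-! Lower bound: for a point `a` of a design put t(x) = ⟨a, x⟩. The cubic t²(t + 1) is nonnegative
on the sphere, has mean 1/(d + 1) and takes the value 2 at `a`, so 2/n ≤ 1/(d + 1).

Existence: put D = d + 1. By symmetry the sphere has vanishing moments of degrees 1 and 3 and second
moments δᵢⱼ/D, so a design is a set of unit vectors with these moments. For n = 2M ≥ 2D, take an
equal-norm tight frame of M vectors together with its negatives: tightness gives the second moments
and antipodality kills the odd ones (`isThreeDesignFamily_signedFrame`).

For odd n ≥ 2D + 5 and D ≥ 3, take a regular pentagon in a coordinate plane and (n - 5)/2 antipodal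
pairs. The odd moments of the pentagon vanish, and its excess second moment in the plane is offset
by shrinking the frame there, which is possible exactly when n ≥ 5D/2
(`isThreeDesignFamily_pentagon_frame`). What remains are the polygons on the circle and (d, n) = (3,
11), (5, 15), which are orbits of cyclic groups whose frequencies have no signed triple sum
divisible by n. -/

/-! ### Moments of the surface measure -/

open scoped Pointwise in
-- The measure of `s` on the sphere is a multiple of the measure of the cone over `s`, and a linear
-- isometry carries cones to cones.
theorem measurePreserving_toSphere {E : Type*} [NormedAddCommGroup E] [NormedSpace ℝ E]
    [MeasurableSpace E] [BorelSpace E] (μ : Measure E) (e : E ≃ₗᵢ[ℝ] E)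
    (he : MeasurePreserving e μ μ) :
    MeasurePreserving (fun x : Metric.sphere (0 : E) 1 =>
      (⟨e x, by simp⟩ : Metric.sphere (0 : E) 1)) μ.toSphere μ.toSphere := by
  have hm : Measurable (fun x : Metric.sphere (0 : E) 1 =>
      (⟨e x, by simp⟩ : Metric.sphere (0 : E) 1)) :=
    (Continuous.subtype_mk (e.continuous.comp continuous_subtype_val) _).measurable
  refine ⟨hm, Measure.ext fun s hs => ?_⟩
  rw [Measure.map_apply hm hs, Measure.toSphere_apply' _ (hm hs), Measure.toSphere_apply' _ hs]
  congr 1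
  have he' : MeasurePreserving e.toHomeomorph.toMeasurableEquiv μ μ := he
  symm
  rw [← he'.measure_preimage_equiv]
  congr 1
  ext x
  simp only [Set.mem_smul, Set.mem_image, Set.mem_preimage, Subtype.exists]
  constructor
  · rintro ⟨r, hr, _, ⟨y, hy, hys, rfl⟩, hx⟩
    refine ⟨r, hr, e.symm y, ⟨e.symm y, by simpa using hy, by simpa using hys, rfl⟩, ?_⟩
    have hx' : r • y = e x := hx
    rw [← map_smul, hx', e.symm_apply_apply]
  · rintro ⟨r, hr, _, ⟨y, hy, hys, rfl⟩, rfl⟩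
    exact ⟨r, hr, e y, ⟨e y, by simpa using hy, hys, rfl⟩, (map_smul e r y).symm⟩

theorem integral_surfaceMeasure_comp_isometry {d : ℕ}
    (e : EuclideanSpace ℝ (Fin (d + 1)) ≃ₗᵢ[ℝ] EuclideanSpace ℝ (Fin (d + 1)))
    (g : EuclideanSpace ℝ (Fin (d + 1)) → ℝ) :
    ∫ x : UnitSphere d, g (e x) ∂(surfaceMeasure d) = ∫ x : UnitSphere d, g x ∂(surfaceMeasure d) := by
  have h := measurePreserving_toSphere volume e e.measurePreserving
  have hemb : MeasurableEmbedding (fun x : UnitSphere d => (⟨e x, by simp⟩ : UnitSphere d)) := by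
    refine Continuous.measurableEmbedding ?_ ?_
    · exact Continuous.subtype_mk (e.continuous.comp continuous_subtype_val) _
    · intro x y hxy
      exact Subtype.ext (e.injective (congrArg Subtype.val hxy))
  exact h.integral_comp hemb (fun x : UnitSphere d => g x)

instance (d : ℕ) : IsFiniteMeasure (surfaceMeasure d) := by
  unfold surfaceMeasure; infer_instance

theorem surfaceMeasure_real_univ_pos (d : ℕ) : 0 < (surfaceMeasure d).real Set.univ := by
  have : surfaceMeasure d ≠ 0 := Measure.toSphere_ne_zero _
  rw [measureReal_def]
  exact ENNReal.toReal_pos (by simpa using this) (measure_ne_top _ _)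

theorem continuous_polyValue {d : ℕ} (f : MvPolynomial (Fin (d + 1)) ℝ) :
    Continuous (polyValue f) := by
  unfold polyValue
  exact (MvPolynomial.continuous_eval f).comp (by fun_prop)

theorem integrable_of_continuous {d : ℕ} {g : UnitSphere d → ℝ} (hg : Continuous g) :
    Integrable g (surfaceMeasure d) :=
  hg.integrable_of_hasCompactSupport (HasCompactSupport.of_compactSpace g)

theorem integral_eq_zero_of_odd {d : ℕ} (g : EuclideanSpace ℝ (Fin (d + 1)) → ℝ)
    (hg : ∀ x, g (-x) = - g x) : ∫ x : UnitSphere d, g x ∂(surfaceMeasure d) = 0 := by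
  have h := integral_surfaceMeasure_comp_isometry (LinearIsometryEquiv.neg ℝ) g
  simp only [LinearIsometryEquiv.coe_neg, hg, integral_neg] at h
  linarith

theorem integral_coord_mul_coord_of_ne {d : ℕ} {i j : Fin (d + 1)} (hij : i ≠ j) :
    ∫ x : UnitSphere d, x.1 i * x.1 j ∂(surfaceMeasure d) = 0 := by
  -- Reflecting the `i`-th coordinate changes the sign of the integrand.
  have h := integral_surfaceMeasure_comp_isometry
    (LinearIsometryEquiv.piLpCongrRight 2 (fun k : Fin (d + 1) =>
      if k = i then LinearIsometryEquiv.neg ℝ else LinearIsometryEquiv.refl ℝ ℝ))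
    (fun x => x i * x j)
  simp [hij.symm, integral_neg] at h
  linarith

theorem integral_coord_sq_eq {d : ℕ} (i j : Fin (d + 1)) :
    ∫ x : UnitSphere d, x.1 i * x.1 i ∂(surfaceMeasure d)
      = ∫ x : UnitSphere d, x.1 j * x.1 j ∂(surfaceMeasure d) := by
  have h := integral_surfaceMeasure_comp_isometry
    (LinearIsometryEquiv.piLpCongrLeft 2 ℝ ℝ (Equiv.swap i j)) (fun x => x i * x i)
  simpa [LinearIsometryEquiv.piLpCongrLeft_apply, Equiv.piCongrLeft'] using h.symm

theorem sum_coord_sq {d : ℕ} (x : UnitSphere d) : ∑ i, x.1 i * x.1 i = 1 := by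
  have h : ‖x.1‖ = 1 := by simp
  have h2 := EuclideanSpace.real_norm_sq_eq x.1
  rw [h] at h2
  simp only [← pow_two]
  linarith

theorem integral_coord_mul_coord {d : ℕ} (i j : Fin (d + 1)) :
    ∫ x : UnitSphere d, x.1 i * x.1 j ∂(surfaceMeasure d)
      = if i = j then (surfaceMeasure d).real Set.univ / (d + 1) else 0 := by
  split_ifs with hij
  · subst hij
    have h1 : ∑ j : Fin (d + 1), ∫ x : UnitSphere d, x.1 j * x.1 j ∂(surfaceMeasure d)
        = (surfaceMeasure d).real Set.univ := by
      rw [← integral_finsetSum]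
      · simp only [sum_coord_sq]
        simp
      · intro j _
        exact integrable_of_continuous (by fun_prop)
    rw [Finset.sum_congr rfl fun j _ => integral_coord_sq_eq j i] at h1
    simp at h1
    rw [← h1]
    field_simp
  · exact integral_coord_mul_coord_of_ne hij

/-! ### Mean values as linear functionals on polynomials -/

/-- Integration of polynomials over the sphere, normalised to be a mean value. -/
noncomputable def sphereMean (d : ℕ) : MvPolynomial (Fin (d + 1)) ℝ →ₗ[ℝ] ℝ where
  toFun f := (1 / (surfaceMeasure d).real Set.univ) * ∫ x, polyValue f x ∂(surfaceMeasure d)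
  map_add' f g := by
    rw [← mul_add, ← integral_add (integrable_of_continuous (continuous_polyValue f))
      (integrable_of_continuous (continuous_polyValue g))]
    simp [polyValue]
  map_smul' c f := by
    simp only [polyValue, MvPolynomial.smul_eval, integral_const_mul, RingHom.id_apply, smul_eq_mul]
    ring

/-- The mean of the values of a polynomial over a finite family of points. -/
noncomputable def familyMean {σ κ : Type*} [Fintype κ] (p : κ → σ → ℝ) :
    MvPolynomial σ ℝ →ₗ[ℝ] ℝ where
  toFun f := (1 / (Fintype.card κ : ℝ)) * ∑ k, MvPolynomial.eval (p k) f
  map_add' f g := by simp [Finset.sum_add_distrib, mul_add]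
  map_smul' c f := by
    simp only [MvPolynomial.smul_eval, ← Finset.mul_sum, RingHom.id_apply, smul_eq_mul]
    ring

theorem sphereMean_one (d : ℕ) : sphereMean d 1 = 1 := by
  have := (surfaceMeasure_real_univ_pos d).ne'
  simp [sphereMean, polyValue, this]

open MvPolynomial in
theorem sphereMean_X {d : ℕ} (i : Fin (d + 1)) : sphereMean d (X i) = 0 := by
  simp only [sphereMean, polyValue, LinearMap.coe_mk, AddHom.coe_mk, eval_X]
  rw [integral_eq_zero_of_odd (fun x => x i) (by simp), mul_zero]

open MvPolynomial in
theorem sphereMean_X_mul_X {d : ℕ} (i j : Fin (d + 1)) :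
    sphereMean d (X i * X j) = if i = j then 1 / ((d : ℝ) + 1) else 0 := by
  have := (surfaceMeasure_real_univ_pos d).ne'
  simp only [sphereMean, polyValue, LinearMap.coe_mk, AddHom.coe_mk, eval_X, map_mul,
    integral_coord_mul_coord]
  split_ifs
  · field_simp
  · simp

open MvPolynomial in
theorem sphereMean_X_mul_X_mul_X {d : ℕ} (i j k : Fin (d + 1)) :
    sphereMean d (X i * X j * X k) = 0 := by
  simp only [sphereMean, polyValue, LinearMap.coe_mk, AddHom.coe_mk, eval_X, map_mul]
  rw [integral_eq_zero_of_odd (fun x => x i * x j * x k) (by simp), mul_zero]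

open MvPolynomial in
-- Reduces the design property to finitely many moment identities, since monomials span.
theorem linearMap_eq_of_totalDegree_le_three {σ : Type*} (L L' : MvPolynomial σ ℝ →ₗ[ℝ] ℝ)
    (h0 : L 1 = L' 1) (h1 : ∀ i, L (X i) = L' (X i))
    (h2 : ∀ i j, L (X i * X j) = L' (X i * X j))
    (h3 : ∀ i j k, L (X i * X j * X k) = L' (X i * X j * X k))
    {f : MvPolynomial σ ℝ} (hf : f.totalDegree ≤ 3) : L f = L' f := by
  classical
  rw [f.as_sum, map_sum, map_sum]
  refine Finset.sum_congr rfl fun s hs => ?_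
  have hmon : L (monomial s 1) = L' (monomial s 1) := by
    obtain ⟨m, rfl⟩ := Multiset.toFinsupp.surjective s
    have hdeg : Multiset.card m ≤ 3 := by
      have := (le_totalDegree hs).trans hf
      have h' := Finsupp.card_toMultiset (Multiset.toFinsupp m)
      rw [Multiset.toFinsupp_toMultiset] at h'
      exact h'.trans_le this
    have hm : monomial (Multiset.toFinsupp m) (1 : ℝ) = (m.map X).prod := by
      induction m using Multiset.induction_on with
      | empty => simp
      | cons a t ih =>
        clear hdeg hs ih
        induction t using Multiset.induction_on generalizing a with
        | empty => simp [X]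
        | cons b t ih =>
          rw [← Multiset.singleton_add, map_add, Multiset.toFinsupp_singleton,
            monomial_single_add, ih b, Multiset.singleton_add, Multiset.map_cons,
            Multiset.prod_cons, pow_one]
          simp
    rw [hm]
    interval_cases hc : Multiset.card m
    · rw [Multiset.card_eq_zero] at hc; subst hc; simpa using h0
    · obtain ⟨a, rfl⟩ := Multiset.card_eq_one.1 hc; simpa using h1 a
    · obtain ⟨a, b, rfl⟩ := Multiset.card_eq_two.1 hc; simpa using h2 a b
    · obtain ⟨a, b, c, rfl⟩ := Multiset.card_eq_three.1 hc; simpa [mul_assoc] using h3 a b c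
  have : monomial s (coeff s f) = coeff s f • monomial s (1 : ℝ) := by simp [smul_monomial]
  rw [this, map_smul, map_smul, hmon]

/-! ### The lower bound -/

open MvPolynomial in
theorem card_ge_of_isSphericalDesign_three {d : ℕ} {X : Finset (UnitSphere d)}
    (hX : IsSphericalDesign d 3 X) : 2 * d + 2 ≤ X.card := by
  obtain ⟨⟨a, ha⟩, h⟩ := hX
  let t : MvPolynomial (Fin (d + 1)) ℝ := ∑ i, C (a.1 i) * MvPolynomial.X i
  have ht : t.totalDegree ≤ 1 := by
    refine totalDegree_finsetSum_le fun i _ => (totalDegree_mul _ _).trans ?_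
    simp
  have h2 : (t ^ 2).totalDegree ≤ 2 := (totalDegree_pow _ _).trans (by lia)
  have h3 : (t ^ 3).totalDegree ≤ 3 := (totalDegree_pow _ _).trans (by lia)
  have hdeg : (t ^ 3 + t ^ 2).totalDegree ≤ 3 :=
    (totalDegree_add _ _).trans (max_le h3 (by lia))
  have hL : sphereMean d (t ^ 3 + t ^ 2) = 1 / ((d : ℝ) + 1) := by
    have e2 : t ^ 2 = ∑ i, ∑ j, (a.1 i * a.1 j) • (MvPolynomial.X i * MvPolynomial.X j) := by
      simp only [t, pow_two, Finset.sum_mul_sum, smul_eq_C_mul, C_mul]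
      refine Finset.sum_congr rfl fun i _ => Finset.sum_congr rfl fun j _ => by ring
    have e3 : sphereMean d (t ^ 3) = 0 := by
      simp only [sphereMean, polyValue, LinearMap.coe_mk, AddHom.coe_mk]
      rw [integral_eq_zero_of_odd (fun x => eval (fun i => x i) (t ^ 3)), mul_zero]
      intro x
      simp [t, Finset.sum_neg_distrib, Odd.neg_pow (by decide : Odd 3)]
    have hs := sum_coord_sq a
    rw [map_add, e3, e2, zero_add]
    simp only [map_sum, map_smul, sphereMean_X_mul_X, smul_eq_mul, mul_ite, mul_zero,
      Finset.sum_ite_eq, Finset.mem_univ, if_true]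
    rw [← Finset.sum_mul, hs, one_mul]
  have hval : ∀ x : UnitSphere d, polyValue t x = ∑ i, a.1 i * x.1 i := by
    intro x; simp [polyValue, t]
  have hta : polyValue t a = 1 := by rw [hval, sum_coord_sq]
  -- Expand |a + x|² ≥ 0.
  have hge : ∀ x : UnitSphere d, -1 ≤ polyValue t x := by
    intro x
    have h0 : 0 ≤ ∑ i, (a.1 i + x.1 i) * (a.1 i + x.1 i) :=
      Finset.sum_nonneg fun i _ => mul_self_nonneg _
    have h1 : ∑ i, (a.1 i + x.1 i) * (a.1 i + x.1 i)
        = ∑ i, a.1 i * a.1 i + 2 * ∑ i, a.1 i * x.1 i + ∑ i, x.1 i * x.1 i := by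
      rw [Finset.mul_sum, ← Finset.sum_add_distrib, ← Finset.sum_add_distrib]
      exact Finset.sum_congr rfl fun i _ => by ring
    rw [h1, sum_coord_sq, sum_coord_sq] at h0
    rw [hval]; linarith
  have hpv : ∀ x : UnitSphere d, polyValue (t ^ 3 + t ^ 2) x
      = polyValue t x ^ 3 + polyValue t x ^ 2 := by
    intro x; simp [polyValue]
  -- All terms t²(t + 1) are nonnegative, so the term at `a` alone bounds the sum.
  have hsum : 2 ≤ ∑ x ∈ X, polyValue (t ^ 3 + t ^ 2) x := by
    have hsing := Finset.single_le_sum (f := fun x => polyValue (t ^ 3 + t ^ 2) x)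
      (s := X) (fun x _ => by
        have := hge x
        rw [hpv]; nlinarith [mul_nonneg (by linarith : 0 ≤ polyValue t x + 1)
          (sq_nonneg (polyValue t x))]) ha
    rw [hpv a, hta] at hsing
    linarith
  have hcard : (0 : ℝ) < X.card := by exact_mod_cast Finset.card_pos.2 ⟨a, ha⟩
  have key : sphereMean d (t ^ 3 + t ^ 2) = _ := h _ hdeg
  rw [hL] at key
  have hd : (0 : ℝ) < (d : ℝ) + 1 := by positivity
  field_simp at key
  have : (2 : ℝ) * d + 2 ≤ X.card := by
    rw [key]; nlinarith
  exact_mod_cast this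

/-! ### Designs from moment conditions -/

/-- Moment conditions characterising the spherical `3`-designs among families of unit vectors. -/
structure IsThreeDesignFamily {κ : Type*} [Fintype κ] {D : ℕ} (p : κ → Fin D → ℝ) : Prop where
  injective : Function.Injective p
  norm_one : ∀ k, ∑ i, p k i ^ 2 = 1
  first : ∀ i, ∑ k, p k i = 0
  second : ∀ i j, ∑ k, p k i * p k j = if i = j then (Fintype.card κ : ℝ) / D else 0
  third : ∀ i j l, ∑ k, p k i * p k j * p k l = 0

theorem IsThreeDesignFamily.exists_design {κ : Type*} [Fintype κ] [Nonempty κ] {d : ℕ}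
    {p : κ → Fin (d + 1) → ℝ} (h : IsThreeDesignFamily p) :
    ∃ X : Finset (UnitSphere d), IsSphericalDesign d 3 X ∧ X.card = Fintype.card κ := by
  let q : κ ↪ UnitSphere d := ⟨fun k => ⟨WithLp.toLp 2 (p k), by
    simp [EuclideanSpace.norm_eq, h.norm_one]⟩, fun k l hkl => h.injective (by
      simpa using congrArg Subtype.val hkl)⟩
  have hc : (Fintype.card κ : ℝ) ≠ 0 := by exact_mod_cast Fintype.card_ne_zero
  refine ⟨Finset.univ.map q, ⟨?_, fun f hf => ?_⟩, by simp⟩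
  · simp
  · have := linearMap_eq_of_totalDegree_le_three (sphereMean d) (familyMean p)
      (by simp [sphereMean_one, familyMean, hc])
      (by simp [sphereMean_X, familyMean, h.first])
      (by
        intro i j
        simp only [sphereMean_X_mul_X, familyMean, LinearMap.coe_mk, AddHom.coe_mk, map_mul,
          MvPolynomial.eval_X, h.second]
        split_ifs
        · push_cast; field_simp
        · simp)
      (by simp [sphereMean_X_mul_X_mul_X, familyMean, h.third]) hf
    simp only [Finset.card_map, Finset.card_univ, Finset.sum_map]
    exact this

/-! ### Trigonometric sums and phases -/

open Real in
-- Multiplication by 2 sin(πr/N), nonzero because N does not divide r, makes the sum telescope over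
-- a whole number of periods.
theorem sum_cos_eq_zero {N : ℕ} {r : ℤ} (h : ¬ (N : ℤ) ∣ r) (φ : ℝ) :
    ∑ k : Fin N, cos (2 * π * r * (k : ℕ) / N + φ) = 0 := by
  rcases Nat.eq_zero_or_pos N with rfl | hN
  · simp
  have hN' : (N : ℝ) ≠ 0 := by positivity
  have hs : sin (π * r / N) ≠ 0 := by
    intro h0
    obtain ⟨m, hm⟩ := sin_eq_zero_iff.1 h0
    refine h ⟨m, ?_⟩
    have := pi_ne_zero
    field_simp at hm
    rw [mul_comm (N : ℤ)]
    exact_mod_cast hm.symm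
  rw [Fin.sum_univ_eq_sum_range (fun k : ℕ => cos (2 * π * r * k / N + φ)) N]
  refine (mul_eq_zero.1 (?_ : (2 * sin (π * r / N)) * _ = 0)).resolve_left (by simpa using hs)
  rw [Finset.mul_sum]
  have hterm : ∀ k ∈ Finset.range N, 2 * sin (π * r / N) * cos (2 * π * r * k / N + φ)
      = sin (2 * π * r * ((k + 1 : ℕ) : ℝ) / N + (φ - π * r / N))
        - sin (2 * π * r * k / N + (φ - π * r / N)) := by
    intro k _
    have e1 : 2 * π * r * ((k + 1 : ℕ) : ℝ) / N + (φ - π * r / N)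
        = (2 * π * r * k / N + φ) + π * r / N := by
      push_cast; ring
    have e2 : 2 * π * r * k / N + (φ - π * r / N) = (2 * π * r * k / N + φ) - π * r / N := by ring
    rw [e1, e2, sin_add, sin_sub]; ring
  rw [Finset.sum_congr rfl hterm,
    Finset.sum_range_sub (fun k : ℕ => sin (2 * π * r * (k : ℝ) / N + (φ - π * r / N)))]
  have e : 2 * π * r * (N : ℝ) / N + (φ - π * r / N) = (φ - π * r / N) + r * (2 * π) := by
    field_simp; ring
  rw [e, sin_add_int_mul_two_pi]
  simp

open Real in
/-- A phase of `π / 4` or `-π / 4`, according to parity. -/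
noncomputable def phase (a : ℕ) : ℝ := if Even a then π / 4 else -(π / 4)

open Real in
-- Phases ±π/4 put a pair of coordinates in quadrature, as cosine and sine would, but also give
-- every coordinate of frequency 0 a nonzero constant value.
theorem cos_phase_add_self (a : ℕ) : cos (phase a + phase a) = 0 := by
  unfold phase
  split_ifs
  · rw [show π / 4 + π / 4 = π / 2 by ring, cos_pi_div_two]
  · rw [show -(π / 4) + -(π / 4) = -(π / 2) by ring, cos_neg, cos_pi_div_two]

open Real in
theorem cos_phase_sub {a b : ℕ} (h : ¬ (Even a ↔ Even b)) : cos (phase a - phase b) = 0 := by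
  unfold phase
  split_ifs with h1 h2 h2
  · exact absurd (iff_of_true h1 h2) h
  · rw [show π / 4 - -(π / 4) = π / 2 by ring, cos_pi_div_two]
  · rw [show -(π / 4) - π / 4 = -(π / 2) by ring, cos_neg, cos_pi_div_two]
  · exact absurd (iff_of_false h1 h2) h

open Real in
theorem sin_add_pi_div_four (x : ℝ) : sin (x + π / 4) = cos (x + -(π / 4)) := by
  rw [← cos_sub_pi_div_two]; congr 1; ring

open Real in
theorem cos_sq_add_cos_sq (x : ℝ) : cos (x + π / 4) ^ 2 + cos (x + -(π / 4)) ^ 2 = 1 := by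
  rw [← sin_add_pi_div_four, cos_sq_add_sin_sq]

open Real in
theorem cos_sub_eq_of_cos_eq {x y ε : ℝ} (h1 : cos (x + π / 4) = ε * cos (y + π / 4))
    (h2 : cos (x + -(π / 4)) = ε * cos (y + -(π / 4))) : cos (x - y) = ε := by
  rw [show x - y = (x + π / 4) - (y + π / 4) by ring, cos_sub, sin_add_pi_div_four,
    sin_add_pi_div_four, h1, h2]
  linear_combination ε * cos_sq_add_cos_sq y

open Real in
theorem eq_of_cos_sub_eq_one {N : ℕ} {k l : Fin N}
    (h : cos (2 * π * (k : ℕ) / N - 2 * π * (l : ℕ) / N) = 1) : k = l := by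
  have hN : (0 : ℝ) < N := by exact_mod_cast k.pos
  have hk : ((k : ℕ) : ℝ) < N := by exact_mod_cast k.2
  have hl : ((l : ℕ) : ℝ) < N := by exact_mod_cast l.2
  have hk0 : (0 : ℝ) ≤ ((k : ℕ) : ℝ) := by positivity
  have hl0 : (0 : ℝ) ≤ ((l : ℕ) : ℝ) := by positivity
  have e : 2 * π * (k : ℕ) / N - 2 * π * (l : ℕ) / N = (((k : ℕ) : ℝ) - (l : ℕ)) / N * (2 * π) := by
    ring
  have h1 : (((k : ℕ) : ℝ) - (l : ℕ)) / N < 1 := by rw [div_lt_one hN]; linarith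
  have h2 : -1 < (((k : ℕ) : ℝ) - (l : ℕ)) / N := by rw [lt_div_iff₀ hN]; linarith
  rw [e] at h
  have hpi := pi_pos
  rw [cos_eq_one_iff_of_lt_of_lt (by nlinarith) (by nlinarith)] at h
  have h3 := (mul_eq_zero.1 h).resolve_right (by positivity)
  have h4 := (div_eq_zero_iff.1 h3).resolve_right hN.ne'
  exact Fin.ext (by exact_mod_cast sub_eq_zero.1 h4)

/-! ### Orbits of cyclic groups -/

open Real in
/-- An orbit of the cyclic group of order `N`, with amplitudes `A` and frequencies `s`. -/
noncomputable def cyclicOrbit (N : ℕ) {D : ℕ} (A : Fin D → ℝ) (s : Fin D → ℤ) :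
    Fin N → Fin D → ℝ :=
  fun k i => A i * cos (2 * π * s i * (k : ℕ) / N + phase i)

section Orbit

open Real

variable {N D : ℕ} {A : Fin D → ℝ} {s : Fin D → ℤ}

theorem sum_cyclicOrbit {i : Fin D} (h : ¬ (N : ℤ) ∣ s i) : ∑ k, cyclicOrbit N A s k i = 0 := by
  simp only [cyclicOrbit]
  rw [← Finset.mul_sum, sum_cos_eq_zero h, mul_zero]

/-- By product-to-sum only the difference frequency can survive. For distinct coordinates of equal
frequency and opposite parity, quadrature removes it. The zero amplitudes serve planar orbits in
higher dimension. -/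
theorem sum_cyclicOrbit_mul {i j : Fin D} (h : ¬ (N : ℤ) ∣ s i + s j)
    (h' : i ≠ j → A i = 0 ∨ A j = 0 ∨ ¬ (N : ℤ) ∣ s i - s j ∨
      s i = s j ∧ ¬ (Even (i : ℕ) ↔ Even (j : ℕ))) :
    ∑ k, cyclicOrbit N A s k i * cyclicOrbit N A s k j = if i = j then A i ^ 2 * N / 2 else 0 := by
  have hexp : ∀ k, cyclicOrbit N A s k i * cyclicOrbit N A s k j = A i * A j / 2 *
      (cos (2 * π * (s i + s j : ℤ) * (k : ℕ) / N + (phase i + phase j))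
        + cos (2 * π * (s i - s j : ℤ) * (k : ℕ) / N + (phase i - phase j))) := by
    intro k
    have e1 : 2 * π * (s i + s j : ℤ) * (k : ℕ) / N + (phase i + phase j)
        = (2 * π * s i * (k : ℕ) / N + phase i) + (2 * π * s j * (k : ℕ) / N + phase j) := by
      push_cast; ring
    have e2 : 2 * π * (s i - s j : ℤ) * (k : ℕ) / N + (phase i - phase j)
        = (2 * π * s i * (k : ℕ) / N + phase i) - (2 * π * s j * (k : ℕ) / N + phase j) := by
      push_cast; ring
    rw [e1, e2, cos_add, cos_sub, cyclicOrbit, cyclicOrbit]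
    ring
  rw [Finset.sum_congr rfl fun k _ => hexp k, ← Finset.mul_sum, Finset.sum_add_distrib,
    sum_cos_eq_zero h, zero_add]
  split_ifs with hij
  · subst hij
    simp
    ring
  · rcases h' hij with h0 | h0 | h0 | ⟨h0, h1⟩
    · simp [h0]
    · simp [h0]
    · rw [sum_cos_eq_zero h0, mul_zero]
    · simp [h0, cos_phase_sub h1]

/-- A triple product contains only the frequencies ±sᵢ ± sⱼ ± sₗ, each of which sums to zero. -/
theorem sum_cyclicOrbit_mul_mul {i j l : Fin D} (h1 : ¬ (N : ℤ) ∣ s i + s j + s l)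
    (h2 : ¬ (N : ℤ) ∣ s i + s j - s l) (h3 : ¬ (N : ℤ) ∣ s i - s j + s l)
    (h4 : ¬ (N : ℤ) ∣ s i - s j - s l) :
    ∑ k, cyclicOrbit N A s k i * cyclicOrbit N A s k j * cyclicOrbit N A s k l = 0 := by
  have hexp : ∀ k, cyclicOrbit N A s k i * cyclicOrbit N A s k j * cyclicOrbit N A s k l
      = A i * A j * A l / 4 *
      (cos (2 * π * (s i + s j + s l : ℤ) * (k : ℕ) / N + (phase i + phase j + phase l))
        + cos (2 * π * (s i + s j - s l : ℤ) * (k : ℕ) / N + (phase i + phase j - phase l))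
        + cos (2 * π * (s i - s j + s l : ℤ) * (k : ℕ) / N + (phase i - phase j + phase l))
        + cos (2 * π * (s i - s j - s l : ℤ) * (k : ℕ) / N + (phase i - phase j - phase l))) := by
    intro k
    simp only [cyclicOrbit]
    generalize hx : 2 * π * s i * (k : ℕ) / N + phase i = x
    generalize hy : 2 * π * s j * (k : ℕ) / N + phase j = y
    generalize hz : 2 * π * s l * (k : ℕ) / N + phase l = z
    have e1 : 2 * π * (s i + s j + s l : ℤ) * (k : ℕ) / N + (phase i + phase j + phase l)
        = x + y + z := by subst hx hy hz; push_cast; ring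
    have e2 : 2 * π * (s i + s j - s l : ℤ) * (k : ℕ) / N + (phase i + phase j - phase l)
        = x + y - z := by subst hx hy hz; push_cast; ring
    have e3 : 2 * π * (s i - s j + s l : ℤ) * (k : ℕ) / N + (phase i - phase j + phase l)
        = x - y + z := by subst hx hy hz; push_cast; ring
    have e4 : 2 * π * (s i - s j - s l : ℤ) * (k : ℕ) / N + (phase i - phase j - phase l)
        = x - y - z := by subst hx hy hz; push_cast; ring
    rw [e1, e2, e3, e4]
    simp only [cos_add, cos_sub, sin_add, sin_sub]
    ring
  rw [Finset.sum_congr rfl fun k _ => hexp k, ← Finset.mul_sum]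
  simp only [Finset.sum_add_distrib]
  rw [sum_cos_eq_zero h1, sum_cos_eq_zero h2, sum_cos_eq_zero h3, sum_cos_eq_zero h4]
  simp

theorem cyclicOrbit_injective {i j : Fin D} (hi : Even (i : ℕ)) (hj : ¬ Even (j : ℕ))
    (hsi : s i = 1) (hsj : s j = 1) (hAi : A i ≠ 0) (hAj : A j ≠ 0) :
    Function.Injective (cyclicOrbit N A s) := by
  intro k l hkl
  have h1 := congrFun hkl i
  have h2 := congrFun hkl j
  simp only [cyclicOrbit, phase, if_pos hi, if_neg hj, hsi, hsj, Int.cast_one, mul_one,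
    mul_right_inj' hAi, mul_right_inj' hAj] at h1 h2
  exact eq_of_cos_sub_eq_one (cos_sub_eq_of_cos_eq (by rw [h1, one_mul]) (by rw [h2, one_mul]))

end Orbit

theorem isThreeDesignFamily_cyclicOrbit_two {N : ℕ} (hN : 4 ≤ N) :
    IsThreeDesignFamily (cyclicOrbit N (D := 2) 1 1) where
  injective := cyclicOrbit_injective (i := 0) (j := 1) (by simp) (by simp) rfl rfl
    (by simp) (by simp)
  norm_one k := by
    simpa [cyclicOrbit, phase] using cos_sq_add_cos_sq _
  first i := sum_cyclicOrbit fun h => by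
    have := Int.le_of_dvd (by simp) h
    simp at this; lia
  second i j := by
    rw [sum_cyclicOrbit_mul]
    · simp
    · intro h
      have := Int.le_of_dvd (by simp) h
      simp at this; lia
    · intro hij
      right; right; right
      refine ⟨rfl, ?_⟩
      revert i j; decide
  third i j l := by
    have key : ∀ z : ℤ, z = 3 ∨ z = 1 ∨ z = -1 → ¬ (N : ℤ) ∣ z := by
      intro z hz h
      have := Int.eq_zero_of_abs_lt_dvd h (by rw [abs_lt]; lia)
      lia
    apply sum_cyclicOrbit_mul_mul <;> apply key <;> simp

/-- Sums of three terms from ±1, ±4 never vanish modulo 11. -/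
theorem isThreeDesignFamily_cyclicOrbit_four :
    IsThreeDesignFamily (cyclicOrbit 11 (D := 4) (fun _ => 1 / √2) ![1, 1, 4, 4]) where
  injective := cyclicOrbit_injective (i := 0) (j := 1) (by simp) (by simp) rfl rfl
    (by simp) (by simp)
  norm_one k := by
    have h1 := cos_sq_add_cos_sq (2 * Real.pi * (1 : ℤ) * (k : ℕ) / 11)
    have h2 := cos_sq_add_cos_sq (2 * Real.pi * (4 : ℤ) * (k : ℕ) / 11)
    simp [Fin.sum_univ_four, cyclicOrbit, phase, mul_pow, show Even 2 by decide,
      show ¬ Even 3 by decide] at h1 h2 ⊢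
    linarith
  first i := sum_cyclicOrbit (by revert i; decide)
  second i j := by
    rw [sum_cyclicOrbit_mul (by revert i j; decide)
      (fun h => Or.inr (Or.inr (by revert i j; decide)))]
    norm_num
  third i j l := by
    apply sum_cyclicOrbit_mul_mul <;> revert i j l <;> decide

/-- Sums of three terms from ±1, ±4, ±6 never vanish modulo 15. -/
theorem isThreeDesignFamily_cyclicOrbit_six :
    IsThreeDesignFamily (cyclicOrbit 15 (D := 6) (fun _ => 1 / √3) ![1, 1, 4, 4, 6, 6]) where
  injective := cyclicOrbit_injective (i := 0) (j := 1) (by simp) (by simp) rfl rfl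
    (by simp) (by simp)
  norm_one k := by
    have h1 := cos_sq_add_cos_sq (2 * Real.pi * (1 : ℤ) * (k : ℕ) / 15)
    have h2 := cos_sq_add_cos_sq (2 * Real.pi * (4 : ℤ) * (k : ℕ) / 15)
    have h3 := cos_sq_add_cos_sq (2 * Real.pi * (6 : ℤ) * (k : ℕ) / 15)
    simp [Fin.sum_univ_six, cyclicOrbit, phase, mul_pow, show Even 2 by decide,
      show ¬ Even 3 by decide, show Even 4 by decide, show ¬ Even 5 by decide] at h1 h2 h3 ⊢
    linarith
  first i := sum_cyclicOrbit (by revert i; decide)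
  second i j := by
    rw [sum_cyclicOrbit_mul (by revert i j; decide)
      (fun h => Or.inr (Or.inr (by revert i j; decide)))]
    norm_num
  third i j l := by
    apply sum_cyclicOrbit_mul_mul <;> revert i j l <;> decide

/-! ### Harmonic tight frames -/

open Real in
/-- The coordinates of a real harmonic frame of `M` vectors of squared norm `D` in dimension `D`. -/
noncomputable def harmonicFrame (D M k a : ℕ) : ℝ :=
  √2 * cos (π * ((D : ℤ) - 1 - 2 * (a / 2 : ℕ) : ℤ) * k / M + phase a)

section Frame

open Real

theorem harmonicFrame_sq (D M k a : ℕ) : harmonicFrame D M k a ^ 2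
    = 2 * cos (π * ((D : ℤ) - 1 - 2 * (a / 2 : ℕ) : ℤ) * k / M + phase a) ^ 2 := by
  rw [harmonicFrame, mul_pow, sq_sqrt (by norm_num)]

theorem harmonicFrame_sq_pair (D M k m : ℕ) :
    harmonicFrame D M k (2 * m) ^ 2 + harmonicFrame D M k (2 * m + 1) ^ 2 = 2 := by
  have h1 : ¬ Even (2 * m + 1) := by simp
  rw [harmonicFrame_sq, harmonicFrame_sq, phase, phase, if_pos (even_two_mul m), if_neg h1,
    show 2 * m / 2 = m by lia, show (2 * m + 1) / 2 = m by lia]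
  linear_combination 2 * cos_sq_add_cos_sq (π * ((D : ℤ) - 1 - 2 * m : ℤ) * k / M)

theorem sum_range_harmonicFrame_sq (D M k m : ℕ) :
    ∑ a ∈ Finset.range (2 * m), harmonicFrame D M k a ^ 2 = 2 * m := by
  induction m with
  | zero => simp
  | succ m ih =>
    rw [show 2 * (m + 1) = 2 * m + 1 + 1 by ring, Finset.sum_range_succ, Finset.sum_range_succ, ih,
      add_assoc, harmonicFrame_sq_pair]
    push_cast; ring

/-- In odd dimension the unpaired coordinate has frequency 0, and √2 cos(π/4) = 1. -/
theorem harmonicFrame_last (M k m : ℕ) : harmonicFrame (2 * m + 1) M k (2 * m) = 1 := by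
  rw [harmonicFrame, show 2 * m / 2 = m by lia, phase, if_pos (even_two_mul m)]
  have : (((2 * m + 1 : ℕ) : ℤ) - 1 - 2 * (m : ℤ)) = 0 := by push_cast; ring
  rw [this]
  simp only [Int.cast_zero, mul_zero, zero_mul, zero_div, zero_add, cos_pi_div_four]
  have := sq_sqrt (show (0 : ℝ) ≤ 2 by norm_num)
  linear_combination this / 2

theorem sum_harmonicFrame_sq (D M k : ℕ) : ∑ i : Fin D, harmonicFrame D M k i ^ 2 = D := by
  rw [Fin.sum_univ_eq_sum_range (fun a => harmonicFrame D M k a ^ 2)]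
  obtain ⟨m, rfl | rfl⟩ := Nat.even_or_odd' D
  · rw [sum_range_harmonicFrame_sq]; push_cast; rfl
  · rw [Finset.sum_range_succ, sum_range_harmonicFrame_sq, harmonicFrame_last]; push_cast; ring

/-- The frequencies D - 1, D - 3, … all have the same parity, so in units of 2π/M the half-sums and
half-differences are integers, of absolute value below M. -/
theorem sum_harmonicFrame_mul {D M : ℕ} (hM : D ≤ M) (i j : Fin D) :
    ∑ k : Fin M, harmonicFrame D M k i * harmonicFrame D M k j = if i = j then (M : ℝ) else 0 := by
  have hexp : ∀ k : Fin M, harmonicFrame D M k i * harmonicFrame D M k j =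
      cos (2 * π * ((D : ℤ) - 1 - (i / 2 : ℕ) - (j / 2 : ℕ) : ℤ) * (k : ℕ) / M
        + (phase i + phase j))
      + cos (2 * π * (((j / 2 : ℕ) : ℤ) - (i / 2 : ℕ) : ℤ) * (k : ℕ) / M
        + (phase i - phase j)) := by
    intro k
    rw [harmonicFrame, harmonicFrame]
    generalize hx : π * ((D : ℤ) - 1 - 2 * (i / 2 : ℕ) : ℤ) * (k : ℕ) / M + phase i = x
    generalize hy : π * ((D : ℤ) - 1 - 2 * (j / 2 : ℕ) : ℤ) * (k : ℕ) / M + phase j = y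
    have e1 : 2 * π * ((D : ℤ) - 1 - (i / 2 : ℕ) - (j / 2 : ℕ) : ℤ) * (k : ℕ) / M
        + (phase i + phase j) = x + y := by
      subst hx hy; push_cast; ring
    have e2 : 2 * π * (((j / 2 : ℕ) : ℤ) - (i / 2 : ℕ) : ℤ) * (k : ℕ) / M
        + (phase i - phase j) = x - y := by
      subst hx hy; push_cast; ring
    rw [e1, e2, cos_add, cos_sub]
    linear_combination cos x * cos y * sq_sqrt (show (0 : ℝ) ≤ 2 by norm_num)
  have hi := i.2
  have hj := j.2
  rw [Finset.sum_congr rfl fun k _ => hexp k, Finset.sum_add_distrib]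
  have hsum : ∑ k : Fin M, cos (2 * π * ((D : ℤ) - 1 - (i / 2 : ℕ) - (j / 2 : ℕ) : ℤ) * (k : ℕ) / M
        + (phase i + phase j)) = 0 := by
    by_cases h : (M : ℤ) ∣ (D : ℤ) - 1 - (i / 2 : ℕ) - (j / 2 : ℕ)
    · have h0 := Int.eq_zero_of_dvd_of_nonneg_of_lt (by lia) (by lia) h
      have hij : (i : ℕ) = j := by lia
      rw [h0, hij]
      simp [cos_phase_add_self]
    · exact sum_cos_eq_zero h _
  rw [hsum, zero_add]
  split_ifs with hij
  · subst hij; simp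
  · by_cases h : (M : ℤ) ∣ ((j / 2 : ℕ) : ℤ) - (i / 2 : ℕ)
    · have h0 := Int.eq_zero_of_abs_lt_dvd h (by rw [abs_lt]; lia)
      have hne : (i : ℕ) ≠ j := fun h => hij (Fin.ext h)
      have hpar : ¬ (Even (i : ℕ) ↔ Even (j : ℕ)) := by
        rw [Nat.even_iff, Nat.even_iff]; lia
      rw [h0]
      simp [cos_phase_sub hpar]
    · exact sum_cos_eq_zero h _

theorem harmonicFrame_eq_iff_cos {D M k l a : ℕ} {ε : ℝ} :
    harmonicFrame D M k a = ε * harmonicFrame D M l a ↔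
      cos (π * ((D : ℤ) - 1 - 2 * (a / 2 : ℕ) : ℤ) * k / M + phase a) =
        ε * cos (π * ((D : ℤ) - 1 - 2 * (a / 2 : ℕ) : ℤ) * l / M + phase a) := by
  rw [harmonicFrame, harmonicFrame, mul_left_comm, mul_right_inj' (by positivity)]

theorem harmonicFrame_cos_pair {D M k l m : ℕ} {ε : ℝ}
    (h1 : harmonicFrame D M k (2 * m) = ε * harmonicFrame D M l (2 * m))
    (h2 : harmonicFrame D M k (2 * m + 1) = ε * harmonicFrame D M l (2 * m + 1)) :
    cos (π * ((D : ℤ) - 1 - 2 * m : ℤ) * k / M - π * ((D : ℤ) - 1 - 2 * m : ℤ) * l / M) = ε := by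
  have h3 : ¬ Even (2 * m + 1) := by simp
  rw [harmonicFrame_eq_iff_cos, phase] at h1 h2
  rw [if_pos (even_two_mul m), show 2 * m / 2 = m by lia] at h1
  rw [if_neg h3, show (2 * m + 1) / 2 = m by lia] at h2
  exact cos_sub_eq_of_cos_eq h1 h2

/-- The last two (or three, in odd dimension) coordinates tell the vectors of the harmonic frame
and their negatives apart. -/
theorem eq_of_harmonicFrame_eq {D M : ℕ} (hD : 2 ≤ D) {k l : Fin M} {ε : ℝ}
    (hε : ε = 1 ∨ ε = -1)
    (h : ∀ i : Fin D, D ≤ i + 2 + D % 2 → harmonicFrame D M k i = ε * harmonicFrame D M l i) :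
    k = l ∧ ε = 1 := by
  obtain ⟨m, rfl | rfl⟩ := Nat.even_or_odd' D
  · obtain ⟨m, rfl⟩ : ∃ q, m = q + 1 := ⟨m - 1, by lia⟩
    have hc := harmonicFrame_cos_pair (h ⟨2 * m, by lia⟩ (by simp; lia))
      (h ⟨2 * m + 1, by lia⟩ (by simp; lia))
    have hr : ((2 * (m + 1) : ℕ) : ℤ) - 1 - 2 * (m : ℤ) = 1 := by push_cast; ring
    rw [hr] at hc
    have hkl : k = l := by
      apply eq_of_cos_sub_eq_one
      -- The lowest frequency advances by π/M only; doubling the angle absorbs the sign ε.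
      have hc2 : cos (2 * (π * (1 : ℤ) * (k : ℕ) / M - π * (1 : ℤ) * (l : ℕ) / M)) = 1 := by
        rw [cos_two_mul, hc]; rcases hε with rfl | rfl <;> norm_num
      rw [← hc2]; congr 1; push_cast; ring
    subst hkl
    exact ⟨rfl, by simpa using hc.symm⟩
  · have h0 := h ⟨2 * m, by lia⟩ (by simp)
    simp only [harmonicFrame_last, mul_one] at h0
    refine ⟨?_, h0.symm⟩
    obtain ⟨m, rfl⟩ : ∃ q, m = q + 1 := ⟨m - 1, by lia⟩
    have hc := harmonicFrame_cos_pair (h ⟨2 * m, by lia⟩ (by simp; lia))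
      (h ⟨2 * m + 1, by lia⟩ (by simp; lia))
    have hr : ((2 * (m + 1) + 1 : ℕ) : ℤ) - 1 - 2 * (m : ℤ) = 2 := by push_cast; ring
    rw [hr, ← h0] at hc
    apply eq_of_cos_sub_eq_one
    rw [← hc]; congr 1; push_cast; ring

/-! ### Rescaled antipodal frames -/

/-- The harmonic frame with its coordinates rescaled, together with the opposite vectors. -/
noncomputable def signedFrame (D M : ℕ) (c : Fin D → ℝ) : Fin M × Bool → Fin D → ℝ :=
  fun x i => (if x.2 then 1 else -1) * (√(c i) * harmonicFrame D M x.1 i)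

variable {D M : ℕ} {c : Fin D → ℝ}

theorem signedFrame_sq (hc : ∀ i, 0 ≤ c i) (x : Fin M × Bool) (i : Fin D) :
    signedFrame D M c x i ^ 2 = c i * harmonicFrame D M x.1 i ^ 2 := by
  rw [signedFrame, mul_pow, mul_pow, sq_sqrt (hc i)]
  split_ifs <;> simp

theorem sum_signedFrame (i : Fin D) : ∑ x, signedFrame D M c x i = 0 := by
  simp [signedFrame, Fintype.sum_prod_type]

theorem sum_signedFrame_mul (hM : D ≤ M) (hc : ∀ i, 0 ≤ c i) (i j : Fin D) :
    ∑ x, signedFrame D M c x i * signedFrame D M c x j = if i = j then 2 * M * c i else 0 := by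
  have hexp : ∑ x, signedFrame D M c x i * signedFrame D M c x j = 2 * (√(c i) * √(c j)) *
      ∑ k : Fin M, harmonicFrame D M k i * harmonicFrame D M k j := by
    rw [Fintype.sum_prod_type, Finset.mul_sum]
    refine Finset.sum_congr rfl fun k _ => ?_
    simp [signedFrame]
    ring
  rw [hexp, sum_harmonicFrame_mul hM]
  split_ifs with hij
  · subst hij
    rw [mul_self_sqrt (hc i)]; ring
  · simp

theorem sum_signedFrame_mul_mul (i j l : Fin D) :
    ∑ x, signedFrame D M c x i * signedFrame D M c x j * signedFrame D M c x l = 0 := by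
  simp [signedFrame, Fintype.sum_prod_type]

/-- Positivity is required only of the last weights because the first two may vanish when a pentagon
is added. -/
theorem signedFrame_injective (hD : 2 ≤ D) (hc : ∀ i : Fin D, D ≤ i + 2 + D % 2 → 0 < c i) :
    Function.Injective (signedFrame D M c) := by
  rintro ⟨k, b⟩ ⟨l, b'⟩ h
  have key := eq_of_harmonicFrame_eq (D := D) (M := M) hD (k := k) (l := l)
    (ε := (if b then 1 else -1) * (if b' then 1 else -1)) (by cases b <;> cases b' <;> simp) (by
      intro i hi
      have h1 := congrFun h i
      simp only [signedFrame] at h1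
      have hpos : √(c i) ≠ 0 := (sqrt_pos.2 (hc i hi)).ne'
      apply mul_left_cancel₀ hpos
      cases b <;> cases b' <;> simp only [if_true, if_false, Bool.false_eq_true] at h1 ⊢ <;>
        linarith)
  obtain ⟨rfl, hε⟩ := key
  cases b <;> cases b' <;> first | rfl | norm_num at hε

end Frame

theorem isThreeDesignFamily_signedFrame {D M : ℕ} (hD : 2 ≤ D) (hM : D ≤ M) :
    IsThreeDesignFamily (signedFrame D M fun _ => 1 / (D : ℝ)) where
  injective := signedFrame_injective hD fun _ _ => by positivity
  norm_one x := by
    simp only [signedFrame_sq (c := fun _ => 1 / (D : ℝ)) (fun _ => by positivity)]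
    rw [← Finset.mul_sum, sum_harmonicFrame_sq]
    field_simp
  first := sum_signedFrame
  second i j := by
    rw [sum_signedFrame_mul hM fun _ => by positivity]
    simp
    congr 1
    ring
  third := sum_signedFrame_mul_mul

/-! ### A pentagon together with an antipodal frame -/

theorem sum_ite_lt_two {D : ℕ} (hD : 2 ≤ D) (g : ℕ → ℝ) :
    ∑ i : Fin D, (if (i : ℕ) < 2 then g i else 0) = g 0 + g 1 := by
  obtain ⟨t, rfl⟩ : ∃ t, D = t + 2 := ⟨D - 2, by lia⟩
  rw [Fin.sum_univ_succ, Fin.sum_univ_succ]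
  simp

/-- A regular pentagon in the plane of the first two coordinates. -/
noncomputable def planarPentagon (D : ℕ) : Fin 5 → Fin D → ℝ :=
  cyclicOrbit 5 (fun i => if (i : ℕ) < 2 then 1 else 0) 1

theorem planarPentagon_sum_sq {D : ℕ} (hD : 2 ≤ D) (k : Fin 5) :
    ∑ i, planarPentagon D k i ^ 2 = 1 := by
  have h := sum_ite_lt_two hD fun a => Real.cos (2 * Real.pi * (k : ℕ) / 5 + phase a) ^ 2
  simp only [phase, Even.zero, if_true, show ¬ Even 1 by decide, if_false, cos_sq_add_cos_sq] at h
  rw [← h]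
  refine Finset.sum_congr rfl fun i _ => ?_
  simp only [planarPentagon, cyclicOrbit]
  split_ifs <;> simp [phase, *]

theorem sum_planarPentagon_mul {D : ℕ} (i j : Fin D) :
    ∑ k, planarPentagon D k i * planarPentagon D k j
      = if i = j then (if (i : ℕ) < 2 then 5 / 2 else 0) else 0 := by
  rw [planarPentagon, sum_cyclicOrbit_mul (by simp)]
  · split_ifs <;> norm_num
  · intro hij
    have hne : (i : ℕ) ≠ j := fun h => hij (Fin.ext h)
    by_cases hi : (i : ℕ) < 2
    · by_cases hj : (j : ℕ) < 2
      · right; right; right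
        refine ⟨rfl, ?_⟩
        rw [Nat.even_iff, Nat.even_iff]; lia
      · simp [hj]
    · simp [hi]

theorem planarPentagon_injective {D : ℕ} (hD : 2 ≤ D) : Function.Injective (planarPentagon D) :=
  cyclicOrbit_injective (i := ⟨0, by lia⟩) (j := ⟨1, by lia⟩) (by simp) (by simp) rfl rfl
    (by simp) (by simp)

/-- With n = 5 + 2M, the weights solve 2Mβ + 5/2 = n/D in the pentagon plane and 2Mα = n/D
elsewhere; `h1` says β ≥ 0. The first two frame coordinates have constant squared sum 2, so
reweighting them keeps all norms equal. -/
theorem isThreeDesignFamily_pentagon_frame {D M : ℕ} (hD : 3 ≤ D) (hM : D ≤ M)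
    (h1 : 5 * D ≤ 2 * (5 + 2 * M)) :
    IsThreeDesignFamily (Sum.elim (planarPentagon D) (signedFrame D M fun i =>
      if (i : ℕ) < 2 then ((5 + 2 * M : ℝ) / D - 5 / 2) / (2 * M)
        else (5 + 2 * M : ℝ) / D / (2 * M))) := by
  set α : ℝ := (5 + 2 * M : ℝ) / D / (2 * M) with hα
  set β : ℝ := ((5 + 2 * M : ℝ) / D - 5 / 2) / (2 * M) with hβ
  have hD0 : (0 : ℝ) < D := by exact_mod_cast (by lia : 0 < D)
  have hM0 : (0 : ℝ) < M := by exact_mod_cast (by lia : 0 < M)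
  have hα0 : 0 < α := by positivity
  have h1' : (5 : ℝ) * D ≤ 2 * (5 + 2 * M) := by exact_mod_cast h1
  have hβ0 : 0 ≤ β := by
    apply div_nonneg _ (by positivity)
    rw [sub_nonneg, div_le_div_iff₀ (by norm_num) hD0]; linarith
  -- For odd D, 5D is odd and the inequality `h1` is strict. This matters for D = 3, where the last
  -- three coordinates include the plane.
  have hβodd : D % 2 = 1 → 0 < β := by
    intro hodd
    have h2 : 5 * D < 2 * (5 + 2 * M) := by lia
    have h2' : (5 : ℝ) * D < 2 * (5 + 2 * M) := by exact_mod_cast h2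
    apply div_pos _ (by positivity)
    rw [sub_pos, div_lt_div_iff₀ (by norm_num) hD0]; linarith
  have hsum : α * D + 2 * (β - α) = 1 := by
    rw [hα, hβ]; field_simp; ring
  set c : Fin D → ℝ := fun i => if (i : ℕ) < 2 then β else α with hcdef
  have hc : ∀ i, 0 ≤ c i := by
    intro i; simp only [hcdef]; split_ifs
    exacts [hβ0, hα0.le]
  have hpair : ∀ k : ℕ, harmonicFrame D M k 0 ^ 2 + harmonicFrame D M k 1 ^ 2 = 2 :=
    fun k => harmonicFrame_sq_pair D M k 0
  have hfirst : ∀ x : Fin M × Bool,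
      ∑ i : Fin D, (if (i : ℕ) < 2 then signedFrame D M c x i ^ 2 else 0) = 2 * β := by
    intro x
    have h := sum_ite_lt_two (by lia : 2 ≤ D) fun a => β * harmonicFrame D M x.1 a ^ 2
    rw [← mul_add, hpair, mul_comm β 2] at h
    rw [← h]
    refine Finset.sum_congr rfl fun i _ => ?_
    rw [signedFrame_sq hc]
    simp only [hcdef]
    split_ifs <;> rfl
  have hnorm : ∀ x, ∑ i, signedFrame D M c x i ^ 2 = 1 := by
    intro x
    have h := sum_ite_lt_two (by lia : 2 ≤ D) fun a => (β - α) * harmonicFrame D M x.1 a ^ 2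
    rw [← mul_add, hpair] at h
    have h' := sum_harmonicFrame_sq D M x.1
    have hterm : ∀ i : Fin D, signedFrame D M c x i ^ 2 = α * harmonicFrame D M x.1 i ^ 2
        + (if (i : ℕ) < 2 then (β - α) * harmonicFrame D M x.1 i ^ 2 else 0) := by
      intro i
      rw [signedFrame_sq hc]
      simp only [hcdef]
      split_ifs <;> ring
    rw [Finset.sum_congr rfl fun i _ => hterm i, Finset.sum_add_distrib, ← Finset.mul_sum, h, h']
    linarith
  refine ⟨?_, ?_, ?_, ?_, ?_⟩
  · refine Function.Injective.sumElim (planarPentagon_injective (by lia))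
      (signedFrame_injective (by lia) ?_) ?_
    · intro i hi
      simp only [hcdef]
      split_ifs with hi2
      · exact hβodd (by lia)
      · exact hα0
    -- The projections to the plane have squared norms 1 and 2β = 1 - (D - 2)α < 1, so the two parts
    -- are disjoint.
    · intro k x hkx
      have h2 := hfirst x
      rw [← hkx] at h2
      have h3 : ∑ i : Fin D, (if (i : ℕ) < 2 then planarPentagon D k i ^ 2 else 0) = 1 := by
        rw [← planarPentagon_sum_sq (by lia : 2 ≤ D) k]
        refine Finset.sum_congr rfl fun i _ => ?_
        split_ifs with hi <;> simp [planarPentagon, cyclicOrbit, hi]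
      have hD3 : (3 : ℝ) ≤ D := by exact_mod_cast hD
      nlinarith
  · rintro (k | x)
    · exact planarPentagon_sum_sq (by lia) k
    · exact hnorm x
  · intro i
    simp only [Fintype.sum_sum_type, Sum.elim_inl, Sum.elim_inr, sum_signedFrame, add_zero]
    exact sum_cyclicOrbit (by simp)
  · intro i j
    simp only [Fintype.sum_sum_type, Sum.elim_inl, Sum.elim_inr, sum_signedFrame_mul hM hc,
      sum_planarPentagon_mul, Fintype.card_sum, Fintype.card_prod, Fintype.card_fin,
      Fintype.card_bool]
    split_ifs with hij hi
    · simp only [hcdef, if_pos hi, hβ]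
      push_cast; field_simp; ring
    · simp only [hcdef, if_neg hi, hα]
      push_cast; field_simp; ring
    · simp
  · intro i j l
    simp only [Fintype.sum_sum_type, Sum.elim_inl, Sum.elim_inr, sum_signedFrame_mul_mul, add_zero]
    apply sum_cyclicOrbit_mul_mul <;> simp

/-! ### Assembly of the cases -/

theorem theorem7p1 (d : ℕ) (hd : 1 ≤ d) :
    (∀ X : Finset (UnitSphere d), IsSphericalDesign d 3 X → 2 * d + 2 ≤ X.card) ∧
    (∀ n : ℕ, Even n → 2 * (d + 1) ≤ n →
      ∃ X : Finset (UnitSphere d), IsSphericalDesign d 3 X ∧ X.card = n) ∧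
    (∀ n : ℕ, Odd n → 5 * ((d : ℝ) + 1) / 2 ≤ (n : ℝ) →
      ¬ (d = 2 ∧ n = 9) → ¬ (d = 4 ∧ n = 13) →
      ∃ X : Finset (UnitSphere d), IsSphericalDesign d 3 X ∧ X.card = n) := by
  refine ⟨fun X hX => card_ge_of_isSphericalDesign_three hX, fun n hn hle => ?_,
    fun n hn hle h9 h13 => ?_⟩
  · obtain ⟨M, rfl⟩ := even_iff_two_dvd.1 hn
    have : NeZero M := ⟨by lia⟩
    obtain ⟨X, hX, hcard⟩ := (isThreeDesignFamily_signedFrame (D := d + 1) (M := M)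
      (by lia) (by lia)).exists_design
    exact ⟨X, hX, by simpa [mul_comm] using hcard⟩
  · have hle' : 5 * (d + 1) ≤ 2 * n := by
      have : 5 * ((d : ℝ) + 1) ≤ 2 * n := by linarith
      exact_mod_cast this
    obtain ⟨q, rfl⟩ := hn
    by_cases hbig : 2 ≤ d ∧ 2 * (d + 1) + 5 ≤ 2 * q + 1
    · obtain ⟨M, rfl⟩ : ∃ M, q = M + 2 := ⟨q - 2, by lia⟩
      obtain ⟨X, hX, hcard⟩ := (isThreeDesignFamily_pentagon_frame (D := d + 1) (M := M)
        (by lia) (by lia) (by lia)).exists_design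
      refine ⟨X, hX, ?_⟩
      simp at hcard
      rw [hcard]; lia
    -- For d ≥ 2, odd n with 5(d + 1)/2 ≤ n < 2(d + 1) + 5 leaves only (2, 9), (3, 11), (4, 13), (5,
    -- 15), of which two are excluded.
    · have hcases : d = 1 ∨ (d = 3 ∧ q = 5) ∨ (d = 5 ∧ q = 7) := by lia
      rcases hcases with rfl | ⟨rfl, rfl⟩ | ⟨rfl, rfl⟩
      · obtain ⟨X, hX, hcard⟩ :=
          (isThreeDesignFamily_cyclicOrbit_two (N := 2 * q + 1) (by lia)).exists_design
        exact ⟨X, hX, by simpa using hcard⟩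
      · obtain ⟨X, hX, hcard⟩ := isThreeDesignFamily_cyclicOrbit_four.exists_design
        exact ⟨X, hX, by simpa using hcard⟩
      · obtain ⟨X, hX, hcard⟩ := isThreeDesignFamily_cyclicOrbit_six.exists_design
        exact ⟨X, hX, by simpa using hcard⟩
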